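/- Let $\gamma>0$ and $\tau<0$, and let $F$ be a distribution function on $\mathbb{R}$ with survival function $\overline F=1-F$ in the class $\mathcal F(\gamma,\tau)$: that is, $x^{1/\gamma}\overline F(x)\to C\in(0,\infty)$ as $x\to\infty$, and the function $\delta$ defined by $\overline F(x)=Cx^{-1/\gamma}\{1+\gamma^{-1}\delta(x)\}$ is eventually nonzero and of constant sign, with $|\delta|$ regularly varying at infinity with index $\tau$. Let $U(y)=\inf\{x\in\mathbb{R}:F(x)\ge 1-1/y\}$ for $y>1$, and define $a$ by $U(y)=C^\gamma y^\gamma\{1+a(y)\}$. Let $X_1,X_2,\dots$ be independent random variables with distribution function $F$, let $X_{1:n}\le\dots\le X_{n:n}$ be the order statistics of $X_1,\dots,X_n$, and let $k=k_n\in\{1,\dots,n-1\}$ be integers with $k\to\infty$, $k/n\to0$ and $\sqrt k\,a(n/k)\to\lambda\in\mathbb{R}$ as $n\to\infty$. Let $x_n\to\infty$, and suppose that $p_n=\overline F(x_n)$ satisfies \[ np_n/k\to0 \qquad\text{and}\qquad \log(np_n)/\sqrt k\to0, \qquad n\to\infty. \] Let $\hat\gamma_n,\hat\delta_n,\hat\tau_n$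 be (arbitrary) sequences of random variables, put $\delta_n=\delta(X_{n-k:n})$, and assume that $\hat\tau_n\to\tau$ in probability and that \[ \Bigl(\sqrt k(\hat\gamma_n-\gamma),\ \sqrt k(\hat\delta_n-\delta_n),\ \sqrt k\{n\overline F(X_{n-k:n})/k-1\}\Bigr)\rightsquigarrow(\Gamma,\Delta,Z),\qquad n\to\infty, \] for some trivariate random vector $(\Gamma,\Delta,Z)$, where $\rightsquigarrow$ denotes convergence in distribution. Let \[ \hat p_{k,n}=\frac kn\,\overline G_{\hat\gamma_n,\hat\delta_n,\hat\tau_n}(x_n/X_{n-k:n}), \] where $\overline G_{\gamma,\delta,\tau}(y)=\{y(1+\delta-\delta y^\tau)\}^{-1/\gamma}$ for $y>1$ and $\overline G_{\gamma,\delta,\tau}(y)=1$ for $y\le1$ is the survival function of the extended Pareto distribution. (This is well defined with probability tending to one; its values on the exceptional events are irrelevant.) Then \[ \frac{\sqrt k}{\log\{k/(np_n)\}}\left(\frac{\hat p_{k,n}}{p_n}-1\right)\rightsquigarrow\gamma^{-1}\Gamma,\qquad n\to\infty. \] -/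

import Mathlib

open MeasureTheory ProbabilityTheory Filter Topology

noncomputable section

namespace EPD

/-- The survival function `1 - F`. -/
def survival (F : ℝ → ℝ) (x : ℝ) : ℝ := 1 - F x

/-- `F` is the distribution function of a probability measure on the real line. -/
def IsDistributionFunction (F : ℝ → ℝ) : Prop :=
  ∃ μ : Measure ℝ, IsProbabilityMeasure μ ∧ ∀ x, F x = cdf μ x

/-- Regular variation at infinity with index `β` of a function that is positive and measurable
on some right neighbourhood of infinity. -/
def RegularlyVarying (f : ℝ → ℝ) (β : ℝ) : Prop :=
  (∃ x₀ : ℝ, Measurable ((Set.Ioi x₀).domRestrict f) ∧ ∀ x, x₀ < x → 0 < f x) ∧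
    ∀ x : ℝ, 0 < x → Tendsto (fun u => f (u * x) / f u) atTop (𝓝 (x ^ β))

/-- The function `δ` defined, for `x > 0`, by
`1 - F x = C * x ^ (-1 / γ) * (1 + δ x / γ)`. -/
def delta (F : ℝ → ℝ) (γ C : ℝ) (x : ℝ) : ℝ :=
  γ * (survival F x / (C * x ^ (-1 / γ)) - 1)

/-- `F` is a distribution function in the second-order class with parameters `γ > 0` and `τ < 0`,
and `C` is the limit of `x ^ (1 / γ) * (1 - F x)`. -/
structure SecondOrderClass (γ τ C : ℝ) (F : ℝ → ℝ) : Prop where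
  isDistributionFunction : IsDistributionFunction F
  gamma_pos : 0 < γ
  tau_neg : τ < 0
  const_pos : 0 < C
  tendsto_const : Tendsto (fun x : ℝ => x ^ (1 / γ) * survival F x) atTop (𝓝 C)
  delta_sign : (∀ᶠ x in atTop, 0 < delta F γ C x) ∨ (∀ᶠ x in atTop, delta F γ C x < 0)
  delta_regularlyVarying : RegularlyVarying (fun x => |delta F γ C x|) τ

/-- The quantile function `Q p = inf {x | p ≤ F x}`. -/
def quantile (F : ℝ → ℝ) (p : ℝ) : ℝ := sInf {x : ℝ | p ≤ F x}

/-- The tail quantile function `U y = Q (1 - 1 / y)`, for `y > 1`. -/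
def tailQuantile (F : ℝ → ℝ) (y : ℝ) : ℝ := quantile F (1 - 1 / y)

/-- The function `a` defined, for `y > 1`, by `U y = C ^ γ * y ^ γ * (1 + a y)`. -/
def auxA (F : ℝ → ℝ) (γ C : ℝ) (y : ℝ) : ℝ :=
  tailQuantile F y / (C ^ γ * y ^ γ) - 1

/-- The distribution function of the extended Pareto distribution. -/
def epdCDF (γ δ τ : ℝ) (y : ℝ) : ℝ :=
  if 1 < y then 1 - (y * (1 + δ - δ * y ^ τ)) ^ (-1 / γ) else 0

/-- The `j`-th smallest of the values `v 0, …, v (n - 1)`, for `1 ≤ j ≤ n` (and `0` for other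
values of `j`). -/
def orderStat {n : ℕ} (v : Fin n → ℝ) (j : ℕ) : ℝ :=
  if h : 1 ≤ j ∧ j ≤ n then v (Tuple.sort v ⟨j - 1, by omega⟩) else 0

/-- The random threshold: the `(n - k)`-th smallest of the first `n` members of the sequence
`X 0, X 1, …`. -/
def threshold {Ω : Type*} (X : ℕ → Ω → ℝ) (n k : ℕ) (ω : Ω) : ℝ :=
  orderStat (fun i : Fin n => X i ω) (n - k)

/-- An intermediate sequence of integers `k n ∈ {1, …, n - 1}`. -/
structure IsIntermediate (k : ℕ → ℕ) : Prop where
  mem : ∀ n, 2 ≤ n → 1 ≤ k n ∧ k n ≤ n - 1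
  tendsto_atTop : Tendsto k atTop atTop
  tendsto_div : Tendsto (fun n => (k n : ℝ) / (n : ℝ)) atTop (𝓝 0)

/-- The normalized exceedance probability of the random threshold `u`:
`Z = √k * (n * (1 - F u) / k - 1)`. -/
def zStat {Ω : Type*} (F : ℝ → ℝ) (X : ℕ → Ω → ℝ) (n k : ℕ) (ω : Ω) : ℝ :=
  √(k : ℝ) * ((n : ℝ) * survival F (threshold X n k ω) / (k : ℝ) - 1)

/-- The estimator of the tail probability at `x` based on the extended Pareto distribution with
parameters `(γ, δ, τ)` fitted to the relative excesses over the random threshold. -/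
def tailEstimator {Ω : Type*} (X : ℕ → Ω → ℝ) (n k : ℕ) (γ δ τ x : ℝ) (ω : Ω) : ℝ :=
  (k : ℝ) / (n : ℝ) * survival (epdCDF γ δ τ) (x / threshold X n k ω)

end EPD

end

/-! With T the random threshold, w = √k and d = log{k/(np)}, taking logarithms of the survival
function at x and T gives log(x/T) = γd + O_P(1/w). The error collects the logarithms of 1 + δ(T)/γ,
of 1 + δ(x)/γ and of n(1 - F(T))/k. Hence p̂/p = exp(d - (γd + E)/γ̂) with E = O_P(1/w), where E
also absorbs the extended Pareto correction. Since d → ∞ and d/w → 0, scaling by w/d kills E and the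
quadratic remainder of exp, leaving γ⁻¹w(γ̂ - γ). Only this coordinate of the joint limit survives;
the other two matter through tightness.

The analytic difficulty is that δ(T) and δ(x) are O(1/w), although the hypothesis controls `auxA`,
that is, the quantile function, and F may jump. `SecondOrderClass.exists_level` turns that control
into a bound on δ at one deterministic level, and `SecondOrderClass.delta_isBigO` carries it to all
larger arguments, as |δ| is almost decreasing.

Probability enters last: `tendstoInMeasure_zero_of_bounded` reduces convergence in probability to a
deterministic limit along a filter on ℕ × Ω, so `SecondOrderClass.tendsto_expansion` is stated for
arbitrary filters. Slutsky's lemma concludes. -/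

namespace EPD

/-! ### Regular variation: a Potter-type bound -/

theorem exists_local_bound_of_tendsto_exp {h : ℝ → ℝ} {β : ℝ} (hm : Measurable h)
    (hpos : ∀ t, 0 < h t)
    (hlim : ∀ u, Tendsto (fun t => h (t + u) / h t) atTop (𝓝 (Real.exp (β * u)))) :
    ∃ M : ℝ, 0 < M ∧ ∃ t₀ : ℝ, ∀ t, t₀ ≤ t → ∀ s, 0 ≤ s → s ≤ 1 → h (t + s) ≤ M * h t := by
  by_contra! hcon
  have hex : ∀ n : ℕ, ∃ t s : ℝ, (n : ℝ) ≤ t ∧ 0 ≤ s ∧ s ≤ 1 ∧ ((n : ℝ) + 1) * h t < h (t + s) := by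
    intro n
    obtain ⟨t, ht, s, h0, h1, hb⟩ := hcon (n + 1) (by positivity) n
    exact ⟨t, s, ht, h0, h1, hb⟩
  choose t s ht hs0 hs1 hbad using hex
  have htt : Tendsto t atTop atTop := tendsto_atTop_mono ht tendsto_natCast_atTop_atTop
  have hts : Tendsto (fun n => t n + s n) atTop atTop :=
    tendsto_atTop_mono (fun n => by linarith [hs0 n, ht n]) tendsto_natCast_atTop_atTop
  -- Pointwise convergence yields convergence in measure on [0, 2], for the ratios based at t n and
  -- at t n + s n alike. The aim is a single u at which both ratios are near their limits; dividing
  -- them bounds h (t n + s n) / h (t n).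
  have hmeas : ∀ r : ℕ → ℝ, Tendsto r atTop atTop →
      TendstoInMeasure (volume.restrict (Set.Icc (0 : ℝ) 2))
        (fun n u => h (r n + u) / h (r n)) atTop (fun u => Real.exp (β * u)) := by
    intro r hr
    refine tendstoInMeasure_of_tendsto_ae (fun n => ?_) (ae_of_all _ fun u => (hlim u).comp hr)
    exact ((hm.comp (measurable_const_add _)).div_const _).aestronglyMeasurable
  set c : ℝ := Real.exp (-(2 * |β|)) with hc
  have hc0 : 0 < c := Real.exp_pos _
  have hbound : ∀ u ∈ Set.Icc (0 : ℝ) 2, c ≤ Real.exp (β * u) ∧ Real.exp (β * u) ≤ c⁻¹ := by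
    intro u hu
    rw [hc, ← Real.exp_neg, Real.exp_le_exp, Real.exp_le_exp, neg_neg, ← abs_le, abs_mul,
      abs_of_nonneg hu.1, mul_comm 2]
    exact mul_le_mul_of_nonneg_left hu.2 (abs_nonneg _)
  have hsmall : ∀ r : ℕ → ℝ, Tendsto r atTop atTop → ∀ᶠ n in atTop,
      volume ({u | ENNReal.ofReal (c / 2) ≤
        edist (h (r n + u) / h (r n)) (Real.exp (β * u))} ∩ Set.Icc (0 : ℝ) 2) < 1 / 3 := by
    intro r hr
    have := (hmeas r hr (ENNReal.ofReal (c / 2)) (by simpa using hc0)).eventually_lt_const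
      (show (0 : ENNReal) < 1 / 3 by simp)
    filter_upwards [this] with n hn
    rwa [Measure.restrict_apply' measurableSet_Icc] at hn
  have hlarge : ∀ᶠ n : ℕ in atTop, (c⁻¹ + c / 2) / (c / 2) ≤ (n : ℝ) :=
    tendsto_natCast_atTop_atTop.eventually_ge_atTop _
  obtain ⟨n, h1, h2, h3⟩ := ((hsmall t htt).and ((hsmall _ hts).and hlarge)).exists
  set A := {u | ENNReal.ofReal (c / 2) ≤ edist (h (t n + u) / h (t n)) (Real.exp (β * u))} ∩
    Set.Icc (0 : ℝ) 2 with hA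
  set B := {u | ENNReal.ofReal (c / 2) ≤
    edist (h (t n + s n + u) / h (t n + s n)) (Real.exp (β * u))} ∩ Set.Icc (0 : ℝ) 2 with hB
  -- Two exceptional sets of measure below 1/3, one of them translated by s n, cannot cover an
  -- interval of length 1. Taking u in [1, 2] keeps u - s n in [0, 2].
  have hex : ∃ u ∈ Set.Icc (1 : ℝ) 2, u ∉ A ∪ (fun u => u + -s n) ⁻¹' B := by
    by_contra! hall
    have hle : volume (Set.Icc (1 : ℝ) 2) ≤ volume A + volume B := by
      refine (measure_mono hall).trans ((measure_union_le _ _).trans ?_)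
      rw [measure_preimage_add_right]
    have hlt : volume A + volume B < 1 / 3 + 1 / 3 := ENNReal.add_lt_add h1 h2
    have h23 : (1 / 3 + 1 / 3 : ENNReal) ≤ 1 := by
      rw [ENNReal.div_add_div_same]
      exact ENNReal.div_le_of_le_mul (by norm_num)
    rw [Real.volume_Icc] at hle
    norm_num at hle
    exact absurd (hle.trans_lt hlt) (not_lt.mpr (by simpa using h23))
  obtain ⟨u, hu, hnot⟩ := hex
  rw [Set.mem_union, not_or] at hnot
  have hu0 : u ∈ Set.Icc (0 : ℝ) 2 := ⟨by linarith [hu.1], hu.2⟩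
  have hv0 : u - s n ∈ Set.Icc (0 : ℝ) 2 :=
    ⟨by linarith [hu.1, hs1 n], by linarith [hu.2, hs0 n]⟩
  have hd1 : |h (t n + u) / h (t n) - Real.exp (β * u)| < c / 2 := by
    by_contra! hge
    refine hnot.1 ⟨?_, hu0⟩
    rw [Set.mem_ofPred_eq, edist_dist, Real.dist_eq]
    exact ENNReal.ofReal_le_ofReal hge
  have hd2 : |h (t n + u) / h (t n + s n) - Real.exp (β * (u - s n))| < c / 2 := by
    by_contra! hge
    refine hnot.2 ⟨?_, by simpa [sub_eq_add_neg] using hv0⟩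
    rw [Set.mem_ofPred_eq, edist_dist, Real.dist_eq]
    refine ENNReal.ofReal_le_ofReal ?_
    have e1 : t n + s n + (u + -s n) = t n + u := by ring
    rw [e1]
    exact hge
  have k1 : h (t n + u) ≤ (c⁻¹ + c / 2) * h (t n) := by
    rw [← div_le_iff₀ (hpos _)]
    linarith [(abs_lt.mp hd1).2, (hbound u hu0).2]
  have k2 : c / 2 * h (t n + s n) ≤ h (t n + u) := by
    rw [← le_div_iff₀ (hpos _)]
    linarith [(abs_lt.mp hd2).1, (hbound _ hv0).1]
  have k3 : c⁻¹ + c / 2 ≤ n * (c / 2) := by rwa [div_le_iff₀ (by positivity)] at h3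
  have k4 := mul_le_mul_of_nonneg_right k3 (hpos (t n)).le
  have k5 := mul_lt_mul_of_pos_left (hbad n) (show 0 < c / 2 by positivity)
  nlinarith [mul_pos hc0 (hpos (t n))]

/-- As β < 0, unit steps eventually decrease h; the fractional part of s - t costs the constant M of
the local bound. -/
theorem exists_bound_of_tendsto_exp {h : ℝ → ℝ} {β : ℝ} (hβ : β < 0) (hm : Measurable h)
    (hpos : ∀ t, 0 < h t)
    (hlim : ∀ u, Tendsto (fun t => h (t + u) / h t) atTop (𝓝 (Real.exp (β * u)))) :
    ∃ M : ℝ, 0 < M ∧ ∃ t₀ : ℝ, ∀ t, t₀ ≤ t → ∀ s, t ≤ s → h s ≤ M * h t := by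
  obtain ⟨M, hM, t₀, hb⟩ := exists_local_bound_of_tendsto_exp hm hpos hlim
  have h1 : ∀ᶠ t in atTop, h (t + 1) / h t < 1 :=
    (hlim 1).eventually_lt_const (by simpa using hβ)
  obtain ⟨t₁, ht₁⟩ := eventually_atTop.mp h1
  refine ⟨M, hM, max t₀ t₁, fun t ht s hs => ?_⟩
  have hstep : ∀ j : ℕ, h (t + j) ≤ h t := by
    intro j
    induction j with
    | zero => simp
    | succ j ih =>
      have := ht₁ (t + j) (by linarith [le_max_right t₀ t₁, (Nat.cast_nonneg j : (0 : ℝ) ≤ j)])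
      rw [div_lt_one (hpos _)] at this
      push_cast
      rw [← add_assoc]
      exact this.le.trans ih
  have hst : 0 ≤ s - t := sub_nonneg.mpr hs
  have hf := Nat.floor_le hst
  have hf' := Nat.lt_floor_add_one (s - t)
  have := hb (t + ⌊s - t⌋₊)
    (by linarith [le_max_left t₀ t₁, (Nat.cast_nonneg ⌊s - t⌋₊ : (0 : ℝ) ≤ _)])
    (s - t - ⌊s - t⌋₊) (by linarith) (by linarith)
  rw [show t + (⌊s - t⌋₊ : ℝ) + (s - t - ⌊s - t⌋₊) = s by ring] at this
  exact this.trans (mul_le_mul_of_nonneg_left (hstep _) hM.le)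

/-- A regularly varying function with negative index is almost decreasing near infinity. -/
theorem RegularlyVarying.exists_le_mul {f : ℝ → ℝ} {β : ℝ} (hf : RegularlyVarying f β)
    (hβ : β < 0) :
    ∃ M : ℝ, 0 < M ∧ ∃ x₀ : ℝ, ∀ y, x₀ ≤ y → ∀ x, y ≤ x → f x ≤ M * f y := by
  obtain ⟨⟨x₀, hm, hpos⟩, hlim⟩ := hf
  classical
  -- Replacing f by 1 to the left of x₀ makes it measurable and positive everywhere without
  -- affecting limits.
  set g : ℝ → ℝ := fun x => if x₀ < x then f x else 1 with hg
  have hgm : Measurable g := by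
    refine measurable_of_restrict_of_restrict_compl (measurableSet_Ioi (a := x₀)) ?_ ?_
    · convert hm using 1
      ext ⟨x, hx⟩
      simp [hg, Set.domRestrict, Set.mem_Ioi.mp hx]
    · convert measurable_const (a := (1 : ℝ)) using 1
      ext ⟨x, hx⟩
      simp only [Set.mem_compl_iff, Set.mem_Ioi] at hx
      simp [hg, Set.domRestrict, hx]
  have hgpos : ∀ x, 0 < g x := by
    intro x
    by_cases hx : x₀ < x
    · simp [hg, hx, hpos x hx]
    · simp [hg, hx]
  have hgf : g =ᶠ[atTop] f := by
    filter_upwards [eventually_gt_atTop x₀] with x hx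
    simp [hg, hx]
  obtain ⟨M, hM, t₀, hb⟩ := exists_bound_of_tendsto_exp (h := fun t => g (Real.exp t)) hβ
    (hgm.comp Real.measurable_exp) (fun t => hgpos _) (fun u => by
      have h1 : Tendsto (fun x => g (x * Real.exp u) / g x) atTop (𝓝 (Real.exp u ^ β)) := by
        refine (hlim _ (Real.exp_pos u)).congr' ?_
        have h2 : Tendsto (fun x => x * Real.exp u) atTop atTop :=
          tendsto_id.atTop_mul_const (Real.exp_pos u)
        filter_upwards [hgf, h2.eventually hgf] with x h3 h4
        rw [h3, h4]
      have h5 := h1.comp Real.tendsto_exp_atTop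
      rw [← Real.exp_mul, mul_comm u β] at h5
      refine h5.congr fun t => ?_
      simp [Real.exp_add])
  refine ⟨M, hM, max (max 1 (x₀ + 1)) (Real.exp t₀), fun y hy x hx => ?_⟩
  have hy1 : 1 ≤ y := (le_max_left _ _).trans ((le_max_left _ _).trans hy)
  have hy2 : x₀ + 1 ≤ y := (le_max_right _ _).trans ((le_max_left _ _).trans hy)
  have hy3 : Real.exp t₀ ≤ y := (le_max_right _ _).trans hy
  have hy0 : 0 < y := by linarith
  have := hb (Real.log y) ((Real.le_log_iff_exp_le hy0).mpr hy3) (Real.log x)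
    (Real.log_le_log hy0 hx)
  simp only [Real.exp_log hy0, Real.exp_log (hy0.trans_le hx)] at this
  simpa [hg, show x₀ < y by linarith, show x₀ < x by linarith] using this

/-! ### The second-order class and the size of δ -/

open Asymptotics

namespace SecondOrderClass

variable {γ τ C : ℝ} {F : ℝ → ℝ}

theorem survival_antitone (h : SecondOrderClass γ τ C F) : Antitone (survival F) := by
  obtain ⟨μ, hμ, hF⟩ := h.isDistributionFunction
  intro x y hxy
  simp only [survival, hF]
  linarith [monotone_cdf μ hxy]

theorem survival_eq (h : SecondOrderClass γ τ C F) {x : ℝ} (hx : 0 < x) :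
    survival F x = C * x ^ (-1 / γ) * (1 + delta F γ C x / γ) := by
  have h1 := h.gamma_pos
  have h2 : C * x ^ (-1 / γ) ≠ 0 := (mul_pos h.const_pos (Real.rpow_pos_of_pos hx _)).ne'
  rw [delta, mul_div_cancel_left₀ _ h1.ne', add_sub_cancel, mul_div_cancel₀ _ h2]

theorem tendsto_delta (h : SecondOrderClass γ τ C F) :
    Tendsto (delta F γ C) atTop (𝓝 0) := by
  have h1 : Tendsto (fun x => γ * (x ^ (1 / γ) * survival F x / C - 1)) atTop
      (𝓝 (γ * (C / C - 1))) := ((h.tendsto_const.div_const C).sub_const 1).const_mul γ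
  rw [div_self h.const_pos.ne', sub_self, mul_zero] at h1
  refine h1.congr' ?_
  filter_upwards [eventually_gt_atTop 0] with x hx
  have h2 : x ^ (1 / γ) ≠ 0 := (Real.rpow_pos_of_pos hx _).ne'
  have h3 := h.const_pos.ne'
  rw [delta, neg_div, Real.rpow_neg hx.le]
  field_simp

theorem survival_pos (h : SecondOrderClass γ τ C F) (x : ℝ) : 0 < survival F x := by
  have h1 : ∀ᶠ y in atTop, 0 < y ^ (1 / γ) * survival F y :=
    h.tendsto_const.eventually_const_lt h.const_pos
  obtain ⟨y, hy, hy0, hxy⟩ :=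
    (h1.and ((eventually_gt_atTop 0).and (eventually_ge_atTop x))).exists
  exact (pos_of_mul_pos_right hy (Real.rpow_nonneg hy0.le _)).trans_le (h.survival_antitone hxy)

theorem survival_scaled (h : SecondOrderClass γ τ C F) {y v : ℝ} (hy : 0 < y) (hv : 0 < v) :
    y * survival F (C ^ γ * y ^ γ * v) =
      v ^ (-1 / γ) * (1 + delta F γ C (C ^ γ * y ^ γ * v) / γ) := by
  have hC := h.const_pos
  have hγ := h.gamma_pos
  have h1 := Real.rpow_pos_of_pos hC γ
  have h2 := Real.rpow_pos_of_pos hy γ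
  have h3 : γ * (-1 / γ) = -1 := by field_simp
  rw [h.survival_eq (by positivity), Real.mul_rpow (by positivity) hv.le,
    Real.mul_rpow h1.le h2.le, ← Real.rpow_mul hC.le, ← Real.rpow_mul hy.le, h3,
    Real.rpow_neg_one, Real.rpow_neg_one]
  field_simp

theorem delta_ne_zero (h : SecondOrderClass γ τ C F) : ∀ᶠ x in atTop, 0 < |delta F γ C x| := by
  rcases h.delta_sign with h1 | h1
  · filter_upwards [h1] with x hx using abs_pos.mpr hx.ne'
  · filter_upwards [h1] with x hx using abs_pos.mpr hx.ne

theorem delta_half_isBigO (h : SecondOrderClass γ τ C F) :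
    (fun x => delta F γ C (x * (1 / 2))) =O[atTop] delta F γ C := by
  have h1 := h.delta_regularlyVarying.2 (1 / 2) (by norm_num)
  refine IsBigO.of_bound ((1 / 2 : ℝ) ^ τ + 1) ?_
  filter_upwards [h1.eventually_lt_const (lt_add_one _), h.delta_ne_zero] with x h2 h3
  rw [div_lt_iff₀ h3] at h2
  exact h2.le

end SecondOrderClass

theorem isBigO_one_add_rpow_sub_one (q : ℝ) :
    (fun b : ℝ => (1 + b) ^ q - 1) =O[𝓝 0] fun b => b := by
  have h1 : HasDerivAt (fun b : ℝ => (1 + b) ^ q) (1 * q * (1 + 0) ^ (q - 1)) 0 :=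
    ((hasDerivAt_id' (0 : ℝ)).const_add 1).rpow_const (by simp)
  simpa using h1.isBigO_sub

/-- Positivity of the quantile excludes the default value 0 of `sInf`, so the defining set is
nonempty here and bounded below in the next lemma. -/
theorem le_of_tailQuantile_lt {F : ℝ → ℝ} (hF : Monotone F) {y u : ℝ}
    (h0 : 0 < tailQuantile F y) (hu : tailQuantile F y < u) : 1 - 1 / y ≤ F u := by
  have hne : {x : ℝ | 1 - 1 / y ≤ F x}.Nonempty := by
    by_contra hne
    rw [Set.not_nonempty_iff_eq_empty] at hne
    rw [tailQuantile, quantile, hne, Real.sInf_empty] at h0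
    exact h0.ne' rfl
  obtain ⟨x, hx, hxu⟩ := exists_lt_of_csInf_lt hne hu
  exact le_trans hx (hF hxu.le)

theorem lt_of_lt_tailQuantile {F : ℝ → ℝ} {y u : ℝ}
    (h0 : 0 < tailQuantile F y) (hu : u < tailQuantile F y) : F u < 1 - 1 / y := by
  have hbdd : BddBelow {x : ℝ | 1 - 1 / y ≤ F x} := by
    by_contra hbdd
    rw [tailQuantile, quantile, Real.sInf_of_not_bddBelow hbdd] at h0
    exact h0.ne' rfl
  by_contra! hF
  exact notMem_of_lt_csInf hu hbdd hF

/-- Along an intermediate sequence `y` whose rate `w` balances the second-order term there is a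
deterministic level, asymptotic to `U y / 2`, at which `δ` is `O(1 / w)`. -/
theorem SecondOrderClass.exists_level {γ τ C : ℝ} {F : ℝ → ℝ} (h : SecondOrderClass γ τ C F)
    {ι : Type*} {l : Filter ι} {y w : ι → ℝ} {lam : ℝ} (hy : Tendsto y l atTop)
    (hw : Tendsto w l atTop) (ha : Tendsto (fun i => w i * auxA F γ C (y i)) l (𝓝 lam)) :
    ∃ s : ι → ℝ, Tendsto s l atTop ∧
      (fun i => w i * delta F γ C (s i)) =O[l] (fun _ => (1 : ℝ)) ∧
      Tendsto (fun i => y i * survival F (s i)) l (𝓝 ((1 / 2) ^ (-1 / γ))) := by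
  have hC := h.const_pos
  have hγ := h.gamma_pos
  have hCγ := Real.rpow_pos_of_pos hC γ
  have hwi : Tendsto (fun i => (w i)⁻¹) l (𝓝 0) := hw.inv_tendsto_atTop
  have ha0 : Tendsto (fun i => auxA F γ C (y i)) l (𝓝 0) := by
    have h1 := hwi.mul ha
    rw [zero_mul] at h1
    refine h1.congr' ?_
    filter_upwards [hw.eventually_gt_atTop 0] with i hi
    rw [inv_mul_cancel_left₀ hi.ne']
  obtain ⟨σ, hσ, hcase⟩ : ∃ σ : ℝ, |σ| = 1 ∧ (((∀ᶠ x in atTop, 0 < delta F γ C x) ∧ σ = 1) ∨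
      ((∀ᶠ x in atTop, delta F γ C x < 0) ∧ σ = -1)) := by
    rcases h.delta_sign with h1 | h1
    · exact ⟨1, by simp, Or.inl ⟨h1, rfl⟩⟩
    · exact ⟨-1, by simp, Or.inr ⟨h1, rfl⟩⟩
  -- Since F may jump at U(y), the level is moved to u = U(y)(1 + σ/w²), on the side given by the
  -- sign σ of δ. The shift is o(1/w), so w b keeps the limit of w a.
  set b : ι → ℝ := fun i => (1 + auxA F γ C (y i)) * (1 + σ * (w i)⁻¹ ^ 2) - 1 with hb
  have hwb : Tendsto (fun i => w i * b i) l (𝓝 lam) := by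
    have h1 := ha.add ((ha0.const_add 1).mul (hwi.const_mul σ))
    simp only [mul_zero, add_zero] at h1
    refine h1.congr' ?_
    filter_upwards [hw.eventually_gt_atTop 0] with i hi
    simp only [hb]
    field_simp
    ring
  have hb0 : Tendsto b l (𝓝 0) := by
    have h1 := ((ha0.const_add 1).mul (((hwi.pow 2).const_mul σ).const_add 1)).sub_const 1
    simpa [hb] using h1
  set u : ι → ℝ := fun i => C ^ γ * y i ^ γ * (1 + b i) with hu
  have hscale : Tendsto (fun i => C ^ γ * y i ^ γ) l atTop :=
    ((tendsto_rpow_atTop hγ).comp hy).const_mul_atTop hCγ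
  have h1b : Tendsto (fun i => 1 + b i) l (𝓝 1) := by simpa using hb0.const_add 1
  have hut : Tendsto u l atTop := hscale.atTop_mul_pos one_pos h1b
  have hU : ∀ᶠ i in l, 0 < tailQuantile F (y i) ∧
      u i = tailQuantile F (y i) * (1 + σ * (w i)⁻¹ ^ 2) := by
    filter_upwards [hy.eventually_gt_atTop 0, ha0.eventually_const_lt (show (-1 : ℝ) < 0 by simp)]
      with i hi hai
    have hyγ := Real.rpow_pos_of_pos hi γ
    have h2 : tailQuantile F (y i) = C ^ γ * y i ^ γ * (1 + auxA F γ C (y i)) := by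
      rw [auxA, add_sub_cancel, mul_div_cancel₀ _ (by positivity)]
    refine ⟨?_, ?_⟩
    · rw [h2]
      exact mul_pos (by positivity) (by linarith)
    · rw [h2]
      simp only [hu, hb]
      ring
  have hmono : Monotone F := by
    intro p q hpq
    have := h.survival_antitone hpq
    simp only [survival] at this
    linarith
  -- One inequality suffices: for δ > 0, u lies above U(y), so y(1 - F(u)) ≤ 1 bounds δ(u) from
  -- above; for δ < 0 both inequalities are reversed.
  have hδu : ∀ᶠ i in l, |delta F γ C (u i)| ≤ γ * |(1 + b i) ^ (1 / γ) - 1| := by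
    have hbpos : ∀ᶠ i in l, 0 < 1 + b i := h1b.eventually_const_lt one_pos
    have hkey : ∀ i, 0 < y i → 0 < 1 + b i → y i * survival F (u i) * (1 + b i) ^ (1 / γ) =
        1 + delta F γ C (u i) / γ := by
      intro i hyi hbi
      rw [hu, h.survival_scaled hyi hbi, neg_div, Real.rpow_neg hbi.le]
      have := (Real.rpow_pos_of_pos hbi (1 / γ)).ne'
      field_simp
    rcases hcase with ⟨hs, rfl⟩ | ⟨hs, rfl⟩
    · filter_upwards [hut.eventually hs, hU, hy.eventually_gt_atTop 0, hbpos,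
        hw.eventually_gt_atTop 0] with i h1 h2 h3 h4 h5
      have h6 : tailQuantile F (y i) < u i := by
        rw [h2.2]
        exact lt_mul_of_one_lt_right h2.1 (by have : 0 < (w i)⁻¹ ^ 2 := by positivity
                                              linarith)
      have h7 := le_of_tailQuantile_lt hmono h2.1 h6
      have h8 : y i * survival F (u i) ≤ 1 := by
        rw [← le_div_iff₀' h3, survival]
        linarith
      have h9 := mul_le_mul_of_nonneg_right h8 (Real.rpow_pos_of_pos h4 (1 / γ)).le
      rw [hkey i h3 h4] at h9
      rw [abs_of_pos h1, ← div_le_iff₀' hγ]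
      exact le_trans (by linarith) (le_abs_self _)
    · filter_upwards [hut.eventually hs, hU, hy.eventually_gt_atTop 0, hbpos,
        hw.eventually_gt_atTop 0] with i h1 h2 h3 h4 h5
      have h6 : u i < tailQuantile F (y i) := by
        rw [h2.2]
        exact mul_lt_of_lt_one_right h2.1 (by have : 0 < (w i)⁻¹ ^ 2 := by positivity
                                              linarith)
      have h7 := lt_of_lt_tailQuantile h2.1 h6
      have h8 : 1 ≤ y i * survival F (u i) := by
        rw [← div_le_iff₀' h3, survival]
        linarith
      have h9 := mul_le_mul_of_nonneg_right h8 (Real.rpow_pos_of_pos h4 (1 / γ)).le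
      rw [hkey i h3 h4] at h9
      rw [abs_of_neg h1, ← div_le_iff₀' hγ, neg_div]
      exact le_trans (by linarith) (neg_le_abs _)
  have hδO : (fun i => w i * delta F γ C (u i)) =O[l] (fun _ => (1 : ℝ)) := by
    have h1 : (fun i => delta F γ C (u i)) =O[l] b := by
      refine IsBigO.trans (IsBigO.of_bound γ ?_)
        ((isBigO_one_add_rpow_sub_one (1 / γ)).comp_tendsto hb0)
      filter_upwards [hδu] with i hi using hi
    exact ((isBigO_refl w l).mul h1).trans (hwb.isBigO_one ℝ)
  -- Halving u costs a constant factor in δ, but lifts the limit of y(1 - F) strictly above 1. This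
  -- lets the level be compared with points where that limit equals 1.
  refine ⟨fun i => u i * (1 / 2), hut.atTop_mul_const (by norm_num), ?_, ?_⟩
  · exact ((isBigO_refl w l).mul (h.delta_half_isBigO.comp_tendsto hut)).trans hδO
  · have h1 : Tendsto (fun i => (1 + b i) * (1 / 2)) l (𝓝 (1 / 2)) := by
      simpa only [one_mul] using h1b.mul_const (1 / 2)
    have h2 := (h.tendsto_delta.comp (hut.atTop_mul_const (show (0 : ℝ) < 1 / 2 by norm_num)))
    have h3 := (h1.rpow_const (p := -1 / γ) (Or.inl (by norm_num))).mul
      ((h2.div_const γ).const_add 1)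
    rw [zero_div, add_zero, mul_one] at h3
    refine h3.congr' ?_
    filter_upwards [hy.eventually_gt_atTop 0, h1b.eventually_const_lt one_pos] with i h4 h5
    have := h.survival_scaled h4 (v := (1 + b i) * (1 / 2)) (by positivity)
    simp only [hu, Function.comp, ← mul_assoc] at this ⊢
    rw [this]

/-- Arguments whose exceedance probability is asymptotic to `c / y` with `c ≤ 1` exceed the
reference level of `exists_level`, so `δ` is `O(1 / w)` there. -/
theorem SecondOrderClass.delta_isBigO {γ τ C : ℝ} {F : ℝ → ℝ} (h : SecondOrderClass γ τ C F)
    {ι : Type*} {l : Filter ι} {y w : ι → ℝ} {lam : ℝ} (hy : Tendsto y l atTop)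
    (hw : Tendsto w l atTop) (ha : Tendsto (fun i => w i * auxA F γ C (y i)) l (𝓝 lam))
    {T : ι → ℝ} {c : ℝ} (hc : c ≤ 1) (hT : Tendsto (fun i => y i * survival F (T i)) l (𝓝 c)) :
    Tendsto T l atTop ∧ (fun i => w i * delta F γ C (T i)) =O[l] (fun _ => (1 : ℝ)) := by
  obtain ⟨s, hs, hδ, hlim⟩ := h.exists_level hy hw ha
  have h1 : c < (1 / 2 : ℝ) ^ (-1 / γ) := by
    refine hc.trans_lt (Real.one_lt_rpow_of_pos_of_lt_one_of_neg (by norm_num) (by norm_num) ?_)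
    exact div_neg_of_neg_of_pos (by norm_num) h.gamma_pos
  have hle : ∀ᶠ i in l, s i ≤ T i := by
    filter_upwards [hT.eventually_lt hlim h1, hy.eventually_gt_atTop 0] with i h2 h3
    by_contra! h4
    exact absurd (mul_le_mul_of_nonneg_left (h.survival_antitone h4.le) h3.le) (not_le.mpr h2)
  refine ⟨tendsto_atTop_mono' l hle hs, ?_⟩
  obtain ⟨M, hM, x₀, hb⟩ := h.delta_regularlyVarying.exists_le_mul h.tau_neg
  refine IsBigO.trans ((isBigO_refl w l).mul (IsBigO.of_bound M ?_)) hδ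
  filter_upwards [hle, hs.eventually_ge_atTop x₀] with i h2 h3 using hb _ h3 _ h2

/-! ### Expansion of the relative error -/

section Expansion

variable {ι : Type*} {l : Filter ι} {w : ι → ℝ}

theorem tendsto_zero_of_mul_isBigO_one {f : ι → ℝ} (hw : Tendsto w l atTop)
    (hf : (fun i => w i * f i) =O[l] (fun _ => (1 : ℝ))) : Tendsto f l (𝓝 0) := by
  have h1 := hf.mul_isLittleO ((isLittleO_one_iff ℝ).mpr hw.inv_tendsto_atTop)
  simp only [one_mul] at h1
  refine ((isLittleO_one_iff ℝ).mp h1).congr' ?_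
  filter_upwards [hw.eventually_gt_atTop 0] with i hi
  rw [Pi.inv_apply]
  field_simp

theorem mul_log_one_add_isBigO_one {f : ι → ℝ} (hw : Tendsto w l atTop)
    (hf : (fun i => w i * f i) =O[l] (fun _ => (1 : ℝ))) :
    (fun i => w i * Real.log (1 + f i)) =O[l] (fun _ => (1 : ℝ)) := by
  have h1 : HasDerivAt (fun b : ℝ => Real.log (1 + b)) (1 / (1 + 0)) 0 :=
    ((hasDerivAt_id' (0 : ℝ)).const_add 1).log (by simp)
  have h2 : (fun b : ℝ => Real.log (1 + b)) =O[𝓝 0] fun b => b := by simpa using h1.isBigO_sub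
  exact ((isBigO_refl w l).mul
    (h2.comp_tendsto (tendsto_zero_of_mul_isBigO_one hw hf))).trans hf

/-- The exponent t equals d(g - γ)/g - E/g, so (w/d)t is γ⁻¹w(g - γ) up to o(1), because 1/d → 0.
The remainder of exp is at most t², and (w/d)t² = ((w/d)t)²(d/w) → 0. -/
theorem tendsto_exp_expansion {γ : ℝ} (hγ : 0 < γ) {d g E : ι → ℝ} (hw : Tendsto w l atTop)
    (hd : Tendsto d l atTop) (hdw : Tendsto (fun i => d i / w i) l (𝓝 0))
    (hg : (fun i => w i * (g i - γ)) =O[l] (fun _ => (1 : ℝ)))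
    (hE : (fun i => w i * E i) =O[l] (fun _ => (1 : ℝ))) :
    Tendsto (fun i => w i / d i * (Real.exp (d i - (γ * d i + E i) / g i) - 1) -
      γ⁻¹ * (w i * (g i - γ))) l (𝓝 0) := by
  have hgγ : Tendsto g l (𝓝 γ) := by
    simpa using (tendsto_zero_of_mul_isBigO_one hw hg).add_const γ
  have hgi : Tendsto (fun i => (g i)⁻¹) l (𝓝 γ⁻¹) := hgγ.inv₀ hγ.ne'
  have hdi : Tendsto (fun i => (d i)⁻¹) l (𝓝 0) := hd.inv_tendsto_atTop
  set t : ι → ℝ := fun i => d i - (γ * d i + E i) / g i with ht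
  have hlin : Tendsto (fun i => w i / d i * t i - γ⁻¹ * (w i * (g i - γ))) l (𝓝 0) := by
    have h1 : Tendsto (fun i => (g i)⁻¹ - γ⁻¹) l (𝓝 0) := by simpa using hgi.sub_const γ⁻¹
    have h2 : Tendsto (fun i => (g i)⁻¹ * (d i)⁻¹) l (𝓝 0) := by simpa using hgi.mul hdi
    have h3 := (hg.mul_isLittleO ((isLittleO_one_iff ℝ).mpr h1)).sub
      (hE.mul_isLittleO ((isLittleO_one_iff ℝ).mpr h2))
    simp only [one_mul] at h3
    refine ((isLittleO_one_iff ℝ).mp h3).congr' ?_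
    filter_upwards [hd.eventually_gt_atTop 0, hgγ.eventually_const_lt hγ] with i h4 h5
    simp only [ht]
    field_simp
    ring
  have hW : (fun i => w i / d i * t i) =O[l] (fun _ => (1 : ℝ)) := by
    simpa using (hlin.isBigO_one ℝ).add (hg.const_mul_left γ⁻¹)
  have ht0 : Tendsto t l (𝓝 0) := by
    have h1 := hW.mul_isLittleO ((isLittleO_one_iff ℝ).mpr hdw)
    simp only [one_mul] at h1
    refine ((isLittleO_one_iff ℝ).mp h1).congr' ?_
    filter_upwards [hd.eventually_gt_atTop 0, hw.eventually_gt_atTop 0] with i h4 h5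
    field_simp
  have hrem : Tendsto (fun i => w i / d i * (Real.exp (t i) - 1 - t i)) l (𝓝 0) := by
    have h1 := (hW.mul hW).mul_isLittleO ((isLittleO_one_iff ℝ).mpr hdw)
    simp only [one_mul] at h1
    refine ((isLittleO_one_iff ℝ).mp (IsBigO.trans_isLittleO (IsBigO.of_bound 1 ?_) h1))
    filter_upwards [hd.eventually_gt_atTop 0, hw.eventually_gt_atTop 0,
      ht0.eventually (Metric.ball_mem_nhds 0 one_pos)] with i h4 h5 h6
    rw [one_mul, Real.norm_eq_abs, Real.norm_eq_abs, abs_mul, abs_of_pos (div_pos h5 h4)]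
    have h7 : w i / d i * t i * (w i / d i * t i) * (d i / w i) = w i / d i * t i ^ 2 := by
      field_simp
    rw [h7, abs_of_nonneg (mul_nonneg (div_pos h5 h4).le (sq_nonneg (t i)))]
    refine mul_le_mul_of_nonneg_left (Real.abs_exp_sub_one_sub_id_le ?_) (div_pos h5 h4).le
    simpa [Real.dist_eq] using h6.le
  have := hrem.add hlin
  rw [add_zero] at this
  refine this.congr fun i => ?_
  ring

theorem SecondOrderClass.log_ratio {γ τ C : ℝ} {F : ℝ → ℝ} (h : SecondOrderClass γ τ C F)
    {T x : ℝ} (hT : 0 < T) (hx : 0 < x) :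
    Real.log (survival F T) - Real.log (survival F x) = Real.log (x / T) / γ +
      Real.log (1 + delta F γ C T / γ) - Real.log (1 + delta F γ C x / γ) := by
  have key : ∀ {u : ℝ}, 0 < u → Real.log (survival F u) =
      Real.log C - Real.log u / γ + Real.log (1 + delta F γ C u / γ) := by
    intro u hu
    have h1 := mul_pos h.const_pos (Real.rpow_pos_of_pos hu (-1 / γ))
    have h2 : 0 < 1 + delta F γ C u / γ := by
      have := h.survival_pos u
      rw [h.survival_eq hu] at this
      exact pos_of_mul_pos_right this h1.le
    rw [h.survival_eq hu, Real.log_mul h1.ne' h2.ne',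
      Real.log_mul h.const_pos.ne' (Real.rpow_pos_of_pos hu _).ne', Real.log_rpow hu]
    ring
  rw [key hT, key hx, Real.log_div hx.ne' hT.ne']
  ring

theorem tendsto_log_div_sqrt_atTop : Tendsto (fun x : ℝ => Real.log x / √x) atTop (𝓝 0) := by
  have h1 := (isLittleO_log_rpow_atTop (show (0 : ℝ) < 1 / 2 by norm_num)).tendsto_div_nhds_zero
  simpa only [Real.sqrt_eq_rpow] using h1

/-- The expansion of the tail estimator, along an arbitrary filter: the relative error is governed
by the error of the estimator of `γ` alone. -/
theorem SecondOrderClass.tendsto_expansion {γ τ C : ℝ} {F : ℝ → ℝ} (h : SecondOrderClass γ τ C F)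
    {κ ν T x p ghat dhat θ : ι → ℝ} (hκ : Tendsto κ l atTop) (hν : ∀ᶠ i in l, 0 < ν i)
    (hp : ∀ i, p i = survival F (x i))
    (hp_zero : Tendsto (fun i => ν i * p i / κ i) l (𝓝 0))
    (hp_log : Tendsto (fun i => Real.log (ν i * p i) / √(κ i)) l (𝓝 0))
    (hT : Tendsto T l atTop) (hx : Tendsto x l atTop)
    (hδT : (fun i => √(κ i) * delta F γ C (T i)) =O[l] (fun _ => (1 : ℝ)))
    (hδx : (fun i => √(κ i) * delta F γ C (x i)) =O[l] (fun _ => (1 : ℝ)))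
    (hg : (fun i => √(κ i) * (ghat i - γ)) =O[l] (fun _ => (1 : ℝ)))
    (hdh : (fun i => √(κ i) * (dhat i - delta F γ C (T i))) =O[l] (fun _ => (1 : ℝ)))
    (hz : (fun i => √(κ i) * (ν i * survival F (T i) / κ i - 1)) =O[l] (fun _ => (1 : ℝ)))
    (hθ : ∀ᶠ i in l, θ i < 0) :
    Tendsto (fun i => √(κ i) / Real.log (κ i / (ν i * p i)) *
      (κ i / ν i * survival (epdCDF (ghat i) (dhat i) (θ i)) (x i / T i) / p i - 1) -
        γ⁻¹ * (√(κ i) * (ghat i - γ))) l (𝓝 0) := by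
  have hγ := h.gamma_pos
  have hw : Tendsto (fun i => √(κ i)) l atTop := Real.tendsto_sqrt_atTop.comp hκ
  have hppos : ∀ i, 0 < p i := fun i => by rw [hp]; exact h.survival_pos _
  set d : ι → ℝ := fun i => Real.log (κ i / (ν i * p i)) with hd
  have hdt : Tendsto d l atTop := by
    refine Real.tendsto_log_atTop.comp ?_
    have h1 : Tendsto (fun i => ν i * p i / κ i) l (𝓝[>] 0) := by
      refine tendsto_nhdsWithin_iff.mpr ⟨hp_zero, ?_⟩
      filter_upwards [hν, hκ.eventually_gt_atTop 0] with i h2 h3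
      exact div_pos (mul_pos h2 (hppos i)) h3
    refine h1.inv_tendsto_nhdsGT_zero.congr fun i => ?_
    simp
  have hdw : Tendsto (fun i => d i / √(κ i)) l (𝓝 0) := by
    have h1 := (tendsto_log_div_sqrt_atTop.comp hκ).sub hp_log
    rw [sub_zero] at h1
    refine h1.congr' ?_
    filter_upwards [hν, hκ.eventually_gt_atTop 0] with i h2 h3
    simp only [Function.comp, hd]
    rw [Real.log_div h3.ne' (mul_pos h2 (hppos i)).ne', sub_div]
  set Y : ι → ℝ := fun i => Real.log (x i / T i) with hY
  set e₁ : ι → ℝ := fun i => Real.log (1 + (ν i * survival F (T i) / κ i - 1)) with he₁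
  set e₂ : ι → ℝ := fun i => Real.log (1 + delta F γ C (T i) / γ) with he₂
  set e₃ : ι → ℝ := fun i => Real.log (1 + delta F γ C (x i) / γ) with he₃
  have hdiv : ∀ {f : ι → ℝ}, (fun i => √(κ i) * f i) =O[l] (fun _ => (1 : ℝ)) →
      (fun i => √(κ i) * (f i / γ)) =O[l] (fun _ => (1 : ℝ)) := by
    intro f hf
    refine (hf.const_mul_left γ⁻¹).congr_left fun i => ?_
    ring
  have h₁ := mul_log_one_add_isBigO_one hw hz
  have h₂ := mul_log_one_add_isBigO_one hw (hdiv hδT)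
  have h₃ := mul_log_one_add_isBigO_one hw (hdiv hδx)
  have hR : (fun i => √(κ i) * (γ * (e₁ i - e₂ i + e₃ i))) =O[l] (fun _ => (1 : ℝ)) := by
    refine (((h₁.sub h₂).add h₃).const_mul_left γ).congr_left fun i => ?_
    ring
  -- This is `log_ratio` solved for log(x/T), after writing the difference of log-survivals as d +
  -- e₁.
  have hYeq : ∀ᶠ i in l, Y i = γ * d i + γ * (e₁ i - e₂ i + e₃ i) := by
    filter_upwards [hν, hκ.eventually_gt_atTop 0, hT.eventually_gt_atTop 0,
      hx.eventually_gt_atTop 0] with i h4 h5 h6 h7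
    have h8 := h.log_ratio h6 h7
    have hs := h.survival_pos (T i)
    have h9 : e₁ i = Real.log (ν i) + Real.log (survival F (T i)) - Real.log (κ i) := by
      simp only [he₁, add_sub_cancel]
      rw [Real.log_div (mul_pos h4 hs).ne' h5.ne', Real.log_mul h4.ne' hs.ne']
    have h10 : d i = Real.log (κ i) - (Real.log (ν i) + Real.log (p i)) := by
      simp only [hd]
      rw [Real.log_div h5.ne' (mul_pos h4 (hppos i)).ne', Real.log_mul h4.ne' (hppos i).ne']
    rw [← hp] at h8
    have h11 : Y i / γ = d i + (e₁ i - e₂ i + e₃ i) := by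
      simp only [hY, he₂, he₃]
      linarith
    rw [div_eq_iff hγ.ne'] at h11
    rw [h11]
    ring
  have hYt : Tendsto Y l atTop := by
    have h4 := (hdt.const_mul_atTop hγ).atTop_add (tendsto_zero_of_mul_isBigO_one hw hR)
    exact h4.congr' (hYeq.mono fun i hi => hi.symm)
  set m : ι → ℝ := fun i => dhat i - dhat i * (x i / T i) ^ θ i with hm
  have hy : ∀ᶠ i in l, 1 < x i / T i := by
    filter_upwards [hYt.eventually_gt_atTop 0, hT.eventually_gt_atTop 0,
      hx.eventually_gt_atTop 0] with i h4 h5 h6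
    exact (Real.log_pos_iff (div_pos h6 h5).le).mp h4
  -- As x/T > 1 and θ < 0, the factor 1 - (x/T)^θ lies in (0, 1). Thus only the sign of θ matters.
  have hmO : (fun i => √(κ i) * m i) =O[l] (fun _ => (1 : ℝ)) := by
    have h4 : (fun i => √(κ i) * dhat i) =O[l] (fun _ => (1 : ℝ)) := by
      refine (hdh.add hδT).congr_left fun i => ?_
      ring
    refine IsBigO.trans (IsBigO.of_bound 1 ?_) h4
    filter_upwards [hy, hθ] with i h5 h6
    have h7 : 0 < (x i / T i) ^ θ i := Real.rpow_pos_of_pos (by linarith) _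
    have h8 : (x i / T i) ^ θ i < 1 := Real.rpow_lt_one_of_one_lt_of_neg h5 h6
    rw [one_mul, show √(κ i) * m i = √(κ i) * dhat i * (1 - (x i / T i) ^ θ i) by
      simp only [hm]; ring, norm_mul]
    refine mul_le_of_le_one_right (norm_nonneg _) ?_
    rw [Real.norm_eq_abs, abs_le]
    constructor <;> linarith
  have h₄ := mul_log_one_add_isBigO_one hw hmO
  have hm0 := tendsto_zero_of_mul_isBigO_one hw hmO
  have hE : (fun i => √(κ i) * (γ * (e₁ i - e₂ i + e₃ i) + Real.log (1 + m i)))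
      =O[l] (fun _ => (1 : ℝ)) := by
    refine (hR.add h₄).congr_left fun i => ?_
    ring
  refine (tendsto_exp_expansion hγ hw hdt hdw hg hE).congr' ?_
  filter_upwards [hν, hκ.eventually_gt_atTop 0, hy, hYeq,
    hm0.eventually_const_lt (show (-1 : ℝ) < 0 by norm_num)] with i h4 h5 h6 h7 h8
  have h9 : 0 < 1 + m i := by linarith
  have h10 : 0 < x i / T i := by linarith
  have h11 : survival (epdCDF (ghat i) (dhat i) (θ i)) (x i / T i) =
      Real.exp (-((Y i + Real.log (1 + m i)) / ghat i)) := by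
    rw [survival, epdCDF, if_pos h6, sub_sub_cancel, add_sub_assoc,
      Real.rpow_def_of_pos (mul_pos h10 h9), Real.log_mul h10.ne' h9.ne']
    congr 1
    simp only [hY]
    ring
  have h12 : Real.exp (d i) = κ i / (ν i * p i) :=
    Real.exp_log (div_pos h5 (mul_pos h4 (hppos i)))
  have h13 : κ i / ν i * survival (epdCDF (ghat i) (dhat i) (θ i)) (x i / T i) / p i =
      Real.exp (d i - (γ * d i + (γ * (e₁ i - e₂ i + e₃ i) + Real.log (1 + m i))) / ghat i) := by
    rw [h11, sub_eq_add_neg, Real.exp_add, h12, h7, add_assoc]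
    have := (hppos i).ne'
    field_simp
  rw [h13]

end Expansion

/-! ### Measurability of the estimator -/

theorem measurable_orderStat {n : ℕ} (j : ℕ) :
    Measurable (fun v : Fin n → ℝ => orderStat v j) := by
  by_cases hj : 1 ≤ j ∧ j ≤ n
  · simp only [orderStat, hj, and_self, dite_true]
    refine measurable_of_Iic fun c => ?_
    -- All permutations that sort v give the same sorted vector, so the choice made by `Tuple.sort`
    -- can be replaced by a finite union over permutations.
    have hset : (fun v : Fin n → ℝ => v (Tuple.sort v ⟨j - 1, by omega⟩)) ⁻¹' Set.Iic c =
        ⋃ σ : Equiv.Perm (Fin n), {v : Fin n → ℝ | ∀ a b, a ≤ b → v (σ a) ≤ v (σ b)} ∩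
          {v | v (σ ⟨j - 1, by omega⟩) ≤ c} := by
      ext v
      simp only [Set.mem_preimage, Set.mem_Iic, Set.mem_iUnion, Set.mem_inter_iff,
        Set.mem_ofPred_eq]
      constructor
      · intro hv
        exact ⟨Tuple.sort v, fun a b hab => Tuple.monotone_sort v hab, hv⟩
      · rintro ⟨σ, hmono, hv⟩
        have h1 : v ∘ σ = v ∘ Tuple.sort v :=
          Tuple.comp_sort_eq_comp_iff_monotone.mpr fun a b hab => hmono a b hab
        have h2 := congrFun h1 ⟨j - 1, by omega⟩
        simp only [Function.comp] at h2
        rwa [← h2]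
    rw [hset]
    refine MeasurableSet.iUnion fun σ => MeasurableSet.inter ?_ ?_
    · simp only [Set.ofPred_forall]
      exact MeasurableSet.iInter fun a => MeasurableSet.iInter fun b => MeasurableSet.iInter
        fun _ => measurableSet_le (measurable_pi_apply _) (measurable_pi_apply _)
    · exact measurableSet_le (measurable_pi_apply _) measurable_const
  · simp only [orderStat, hj, dite_false]
    exact measurable_const

theorem measurable_threshold {Ω : Type*} [MeasurableSpace Ω] {X : ℕ → Ω → ℝ}
    (hX : ∀ i, Measurable (X i)) (n k : ℕ) : Measurable (threshold X n k) :=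
  (measurable_orderStat (n - k)).comp (measurable_pi_lambda _ fun i => hX i)

theorem aemeasurable_tailEstimator {Ω : Type*} [MeasurableSpace Ω] {P : Measure Ω}
    {X : ℕ → Ω → ℝ} (hX : ∀ i, Measurable (X i)) (n k : ℕ) {g d t : Ω → ℝ}
    (hg : AEMeasurable g P) (hd : AEMeasurable d P) (ht : AEMeasurable t P) (x : ℝ) :
    AEMeasurable (fun ω => tailEstimator X n k (g ω) (d ω) (t ω) x ω) P := by
  have hm : Measurable (fun q : ℝ × ℝ × ℝ × ℝ =>
      survival (epdCDF q.1 q.2.1 q.2.2.1) q.2.2.2) := by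
    refine measurable_const.sub (Measurable.ite ?_ ?_ measurable_const)
    · exact measurableSet_lt measurable_const (by fun_prop)
    · fun_prop
  have hT : AEMeasurable (fun ω => x / threshold X n k ω) P :=
    ((measurable_threshold hX n k).const_div x).aemeasurable
  exact (hm.comp_aemeasurable (hg.prodMk (hd.prodMk (ht.prodMk hT)))).const_mul _

/-! ### From tightness to convergence in probability -/

section Tight

variable {Ω Ω' E : Type*} [MeasurableSpace Ω] [MeasurableSpace Ω'] {P : Measure Ω}
  [IsProbabilityMeasure P] {P' : Measure Ω'} [IsProbabilityMeasure P']
  [NormedAddCommGroup E] [MeasurableSpace E] [BorelSpace E] {V : ℕ → Ω → E} {W : Ω' → E}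

/-- The closed sets {K ≤ ‖v‖} shrink to ∅, so one has small mass under the limit law; the
portmanteau theorem transfers this to large n. -/
theorem exists_norm_bound_of_tendstoInDistribution
    (h : TendstoInDistribution V atTop W (fun _ => P) P') {η : ENNReal} (hη : 0 < η) :
    ∃ K : ℝ, ∀ᶠ n in atTop, P {ω | K ≤ ‖V n ω‖} < η := by
  have hclosed : ∀ K : ℝ, IsClosed {v : E | K ≤ ‖v‖} := fun K =>
    isClosed_le continuous_const continuous_norm
  have hlim : Tendsto (fun m : ℕ => P'.map W {v : E | (m : ℝ) ≤ ‖v‖}) atTop (𝓝 0) := by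
    have : IsProbabilityMeasure (P'.map W) :=
      Measure.isProbabilityMeasure_map h.aemeasurable_limit
    have h1 := tendsto_measure_iInter_atTop (μ := P'.map W)
      (s := fun m : ℕ => {v : E | (m : ℝ) ≤ ‖v‖})
      (fun m => (hclosed m).measurableSet.nullMeasurableSet)
      (fun a b hab => Set.ofPred_subset_ofPred.mpr fun v hv =>
        (Nat.cast_le.mpr hab).trans hv) ⟨0, measure_ne_top _ _⟩
    have h2 : (⋂ m : ℕ, {v : E | (m : ℝ) ≤ ‖v‖}) = ∅ := by
      ext v
      simp only [Set.mem_iInter, Set.mem_ofPred_eq, Set.mem_empty_iff_false, iff_false, not_forall,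
        not_le]
      exact exists_nat_gt ‖v‖
    rwa [h2, measure_empty] at h1
  obtain ⟨m, hm⟩ := (hlim.eventually_lt_const hη).exists
  refine ⟨m, ?_⟩
  have h3 := ProbabilityMeasure.limsup_measure_closed_le_of_tendsto h.tendsto (hclosed m)
  have h4 := eventually_lt_of_limsup_lt (h3.trans_lt hm)
  filter_upwards [h4] with n hn
  refine lt_of_eq_of_lt ?_ hn
  simp only [ProbabilityMeasure.coe_mk]
  rw [Measure.map_apply_of_aemeasurable (h.forall_aemeasurable n) (hclosed m).measurableSet]
  rfl

/-- If `f` vanishes uniformly on the sets where `V` stays bounded and `D` does not occur, then it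
vanishes in probability as soon as `V` converges in distribution and `P (D n) → 0`. -/
theorem tendstoInMeasure_zero_of_bounded
    (h : TendstoInDistribution V atTop W (fun _ => P) P') {D : ℕ → Set Ω}
    (hD : Tendsto (fun n => P (D n)) atTop (𝓝 0)) {f : ℕ → Ω → ℝ}
    (hf : ∀ K : ℝ, Tendsto (fun q : ℕ × Ω => f q.1 q.2)
      (comap Prod.fst atTop ⊓ 𝓟 {q | ‖V q.1 q.2‖ ≤ K ∧ q.2 ∉ D q.1}) (𝓝 0)) :
    TendstoInMeasure P f atTop 0 := by
  rw [tendstoInMeasure_iff_norm]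
  intro ε hε
  rw [ENNReal.tendsto_nhds_zero]
  intro η hη
  have hη2 : 0 < η / 2 := ENNReal.half_pos hη.ne'
  obtain ⟨K, hK⟩ := exists_norm_bound_of_tendstoInDistribution h hη2
  have h1 := (hf K).eventually (Metric.ball_mem_nhds 0 hε)
  -- A limit along this filter is uniform in ω over the good set of each n.
  rw [eventually_inf_principal, eventually_comap] at h1
  filter_upwards [hK, hD.eventually_lt_const hη2, h1] with n h2 h3 h4
  calc P {ω | ε ≤ ‖f n ω - (0 : Ω → ℝ) ω‖} ≤ P ({ω | K ≤ ‖V n ω‖} ∪ D n) := by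
        refine measure_mono fun ω hω => ?_
        by_contra hnot
        rw [Set.mem_union, not_or, Set.mem_ofPred_eq, not_le] at hnot
        have h5 := h4 (n, ω) rfl ⟨hnot.1.le, hnot.2⟩
        simp only [Set.mem_ofPred_eq, Pi.zero_apply, sub_zero] at hω
        rw [dist_zero_right] at h5
        exact absurd hω (not_le.mpr h5)
    _ ≤ P {ω | K ≤ ‖V n ω‖} + P (D n) := measure_union_le _ _
    _ ≤ η / 2 + η / 2 := add_le_add h2.le h3.le
    _ = η := ENNReal.add_halves η

end Tight

end EPD

/-! ### Assembly -/

theorem theorem3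
    {Ω Ω' : Type*} [MeasurableSpace Ω] [MeasurableSpace Ω']
    (P : Measure Ω) [IsProbabilityMeasure P] (P' : Measure Ω') [IsProbabilityMeasure P']
    -- the distribution function
    (γ τ C : ℝ) (F : ℝ → ℝ) (hF : EPD.SecondOrderClass γ τ C F)
    -- the independent sample
    (X : ℕ → Ω → ℝ) (hX_meas : ∀ i, Measurable (X i)) (hX_indep : iIndepFun X P)
    (hX_law : ∀ i x, cdf (P.map (X i)) x = F x)
    -- the intermediate sequence
    (k : ℕ → ℕ) (hk : EPD.IsIntermediate k) (lam : ℝ)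
    (hk_lam : Tendsto (fun n : ℕ => √(k n : ℝ) * EPD.auxA F γ C ((n : ℝ) / (k n : ℝ))) atTop (𝓝 lam))
    -- the tail probabilities
    (x : ℕ → ℝ) (hx : Tendsto x atTop atTop)
    (p : ℕ → ℝ) (hp : ∀ n, p n = EPD.survival F (x n))
    (hp_zero : Tendsto (fun n : ℕ => (n : ℝ) * p n / (k n : ℝ)) atTop (𝓝 0))
    (hp_log : Tendsto (fun n : ℕ => Real.log ((n : ℝ) * p n) / √(k n : ℝ)) atTop (𝓝 0))
    -- the estimator sequences and their joint asymptotics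
    (γhat δhat τhat : ℕ → Ω → ℝ)
    (hγ_meas : ∀ n, AEMeasurable (γhat n) P) (hδ_meas : ∀ n, AEMeasurable (δhat n) P)
    (hτ_meas : ∀ n, AEMeasurable (τhat n) P)
    (hτ : TendstoInMeasure P τhat atTop (fun _ => τ))
    (Γ Δ Z : Ω' → ℝ)
    (h_joint : TendstoInDistribution
      (fun (n : ℕ) (ω : Ω) =>
        ((√(k n : ℝ) * (γhat n ω - γ),
          √(k n : ℝ) * (δhat n ω - EPD.delta F γ C (EPD.threshold X n (k n) ω)),
          EPD.zStat F X n (k n) ω) : ℝ × ℝ × ℝ))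
      atTop (fun ω' => (Γ ω', Δ ω', Z ω')) (fun _ => P) P') :
    TendstoInDistribution
      (fun (n : ℕ) (ω : Ω) =>
        √(k n : ℝ) / Real.log ((k n : ℝ) / ((n : ℝ) * p n)) *
          (EPD.tailEstimator X n (k n) (γhat n ω) (δhat n ω) (τhat n ω) (x n) ω / p n - 1))
      atTop (fun ω' => γ⁻¹ * Γ ω') (fun _ => P) P' := by
  have hkR : Tendsto (fun n => (k n : ℝ)) atTop atTop :=
    tendsto_natCast_atTop_atTop.comp hk.tendsto_atTop
  have hw : Tendsto (fun n => √(k n : ℝ)) atTop atTop := Real.tendsto_sqrt_atTop.comp hkR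
  have hy : Tendsto (fun n : ℕ => (n : ℝ) / (k n : ℝ)) atTop atTop := by
    have h1 : Tendsto (fun n : ℕ => (k n : ℝ) / (n : ℝ)) atTop (𝓝[>] 0) := by
      refine tendsto_nhdsWithin_iff.mpr ⟨hk.tendsto_div, ?_⟩
      filter_upwards [hkR.eventually_gt_atTop 0, eventually_gt_atTop 0] with n h2 h3
      exact div_pos h2 (Nat.cast_pos.mpr h3)
    refine h1.inv_tendsto_nhdsGT_zero.congr fun n => ?_
    simp
  -- Here c = 0, because np/k → 0; for the threshold below, c = 1.
  have hδx := (hF.delta_isBigO hy hw hk_lam zero_le_one (T := x)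
    (hp_zero.congr fun n => by rw [hp, mul_div_right_comm])).2
  have hlin : TendstoInDistribution (fun (n : ℕ) (ω : Ω) => γ⁻¹ * (√(k n : ℝ) * (γhat n ω - γ)))
      atTop (fun ω' => γ⁻¹ * Γ ω') (fun _ => P) P' :=
    h_joint.continuous_comp (g := fun v : ℝ × ℝ × ℝ => γ⁻¹ * v.1) (by fun_prop)
  refine tendstoInDistribution_of_tendstoInMeasure_sub _ _ hlin ?_ fun n =>
    (((EPD.aemeasurable_tailEstimator hX_meas n (k n) (hγ_meas n) (hδ_meas n) (hτ_meas n)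
      (x n)).div_const _).sub_const 1).const_mul _
  -- Off this event |τ̂ - τ| < -τ, which forces τ̂ < 0.
  have hD : Tendsto (fun n => P {ω | -τ ≤ ‖τhat n ω - τ‖}) atTop (𝓝 0) :=
    tendstoInMeasure_iff_norm.mp hτ (-τ) (neg_pos.mpr hF.tau_neg)
  refine EPD.tendstoInMeasure_zero_of_bounded h_joint hD fun K => ?_
  set l : Filter (ℕ × Ω) := comap Prod.fst atTop ⊓ 𝓟 {q | ‖(√(k q.1 : ℝ) * (γhat q.1 q.2 - γ),
    √(k q.1 : ℝ) * (δhat q.1 q.2 - EPD.delta F γ C (EPD.threshold X q.1 (k q.1) q.2)),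
    EPD.zStat F X q.1 (k q.1) q.2)‖ ≤ K ∧ q.2 ∉ {ω | -τ ≤ ‖τhat q.1 ω - τ‖}} with hl
  have hfst : Tendsto Prod.fst l atTop := tendsto_comap.mono_left inf_le_left
  have hgood : ∀ᶠ q in l, ‖(√(k q.1 : ℝ) * (γhat q.1 q.2 - γ),
      √(k q.1 : ℝ) * (δhat q.1 q.2 - EPD.delta F γ C (EPD.threshold X q.1 (k q.1) q.2)),
      EPD.zStat F X q.1 (k q.1) q.2)‖ ≤ K ∧ q.2 ∉ {ω | -τ ≤ ‖τhat q.1 ω - τ‖} :=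
    (eventually_principal.mpr fun q hq => hq).filter_mono inf_le_right
  have hbdd : ∀ {f : ℕ × Ω → ℝ}, (∀ᶠ q in l, ‖f q‖ ≤ K) →
      f =O[l] (fun _ => (1 : ℝ)) := fun hf =>
    Asymptotics.IsBigO.of_bound K (hf.mono fun q hq => by simpa using hq)
  have hz := hbdd (f := fun q => EPD.zStat F X q.1 (k q.1) q.2) (hgood.mono fun q hq =>
    ((norm_snd_le _).trans (norm_snd_le _)).trans hq.1)
  -- A bounded `zStat` gives n(1 - F(T))/k → 1 along l, so T → ∞ and the bound on δ(T) come from the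
  -- deterministic lemma.
  have hT := hF.delta_isBigO (hy.comp hfst) (hw.comp hfst) (hk_lam.comp hfst) le_rfl
    (T := fun q => EPD.threshold X q.1 (k q.1) q.2) (by
      have h1 := (EPD.tendsto_zero_of_mul_isBigO_one (hw.comp hfst) hz).add_const 1
      rw [zero_add] at h1
      refine h1.congr fun q => ?_
      simp only [Function.comp]
      ring)
  refine hF.tendsto_expansion (κ := fun q : ℕ × Ω => (k q.1 : ℝ)) (ν := fun q => (q.1 : ℝ))
    (x := fun q => x q.1) (p := fun q => p q.1)
    (T := fun q => EPD.threshold X q.1 (k q.1) q.2) (ghat := fun q => γhat q.1 q.2)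
    (dhat := fun q => δhat q.1 q.2) (θ := fun q => τhat q.1 q.2)
    (hkR.comp hfst) ?_ (fun q => hp q.1) (hp_zero.comp hfst) (hp_log.comp hfst) hT.1
    (hx.comp hfst) hT.2 (hδx.comp_tendsto hfst) ?_ ?_ hz ?_
  · filter_upwards [hfst.eventually_gt_atTop 0] with q hq using Nat.cast_pos.mpr hq
  · exact hbdd (hgood.mono fun q hq => (norm_fst_le _).trans hq.1)
  · exact hbdd (hgood.mono fun q hq => ((norm_fst_le _).trans (norm_snd_le _)).trans hq.1)
  · filter_upwards [hgood] with q hq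
    have h1 := hq.2
    rw [not_le, Real.norm_eq_abs] at h1
    linarith [(abs_lt.mp h1).2]
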